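/- For $\beta>0$ let $\mathrm{swish}_\beta(t)=t/(1+e^{-\beta t})$. There is a universal constant $C>0$ such that the following holds for all integers $d,L\ge 0$, all $\beta>0$, all real weights $w_1,\dots,w_d,v_1,\dots,v_d$ with $|w_iv_i|\le 1$ for every $i$, and all inputs $x_1,\dots,x_L\in[-1,1]$. For functions $\phi_1,\dots,\phi_d:\mathbb R\to\mathbb R$ let $\boldsymbol\Psi=(\phi_i(x_k))_{1\le i\le d,\,1\le k\le L}\in\mathbb R^{d\times L}$ be the embedded input, with singular values $\sigma_1\ge\sigma_2\ge\cdots$, where $\sigma_n=0$ for $n>\min(d,L)$. 1. Let $\phi_i(x)=\mathrm{swish}_\beta(w_ix)\,(v_ix)=\dfrac{w_iv_ix^2}{1+e^{-\beta w_ix}}$ (the Time-MoE embedding). For every $W>0$ such that $|w_i|\le W$ for all $i$, and every integer $j\ge 0$, $$\sigma_{j+1}\le C\sqrt{dL}\,\bigl(\beta W+(\beta W)^{-1}\bigr)\Bigl(1+\frac{\pi}{2\beta W}\Bigr)^{-j+1}.$$ In particular, if $|w_i|\le 1$ for all $i$, then $\sigma_{j+1}\le C\sqrt{dL}\,(\beta+\beta^{-1})\bigl(1+\frac{\pi}{2\beta}\bigr)^{-j+1}$.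 2. Let $\phi_i(x)=\dfrac{w_iv_ix^2}{1+e^{-\beta x}}$. Then for every integer $j\ge 0$, $$\sigma_{j+1}\le C\sqrt{dL}\,(\beta+\beta^{-1})\Bigl(1+\frac{\pi}{2\beta}\Bigr)^{-j+1}.$$ -/

import Mathlib

noncomputable section

/-- The swish activation `swish_β(x) = x / (1 + exp(-βx))`. -/
def swish (β x : ℝ) : ℝ := x / (1 + Real.exp (-(β * x)))

/-- One coordinate `x ↦ swish_β(w x) · (v x)` of the Time-MoE embedding. -/
def timeMoE (β w v x : ℝ) : ℝ := swish β (w * x) * (v * x)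

/-- The coordinate `x ↦ w v x² / (1 + exp(-βx))`, in which the weight `w` does not enter the
exponent. -/
def timeMoEUnscaled (β w v x : ℝ) : ℝ := w * v * x ^ 2 / (1 + Real.exp (-(β * x)))

/-- The `d × L` embedded input: its `(i, k)` entry is `φ i (x k)`. -/
def embeddedInput {d L : ℕ} (φ : Fin d → ℝ → ℝ) (x : Fin L → ℝ) : Matrix (Fin d) (Fin L) ℝ :=
  Matrix.of fun i k => φ i (x k)

/-- The singular value `σ_{j+1}(A)`, where `σ_1(A) ≥ σ_2(A) ≥ ⋯` and `σ_n(A) = 0` for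
`n > min(d, L)`. Mathlib numbers singular values from zero. -/
def sigmaSucc {d L : ℕ} (A : Matrix (Fin d) (Fin L) ℝ) (j : ℕ) : ℝ :=
  A.toEuclideanLin.singularValues j

/-- `√(dL) (β + β⁻¹) (1 + π/(2β))^{-j+1}`. -/
def moeRate (d L : ℕ) (β : ℝ) (j : ℕ) : ℝ :=
  Real.sqrt ((d : ℝ) * (L : ℝ)) * (β + β⁻¹) * (1 + Real.pi / (2 * β)) ^ (-(j : ℤ) + 1)

end

open scoped Real InnerProductSpace

/-! Every row samples some `f(x) = a x² / (1 + exp(-c x))` with `|a| ≤ 1`, `|c| ≤ b`. Its poles have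
imaginary part at least `π/b` in modulus, so with `ρ = 1 + π/(2b)` it is holomorphic on the
Bernstein ellipse of parameter `ρ`, and bounded there by `ρ²`. Truncating its Chebyshev series to
`j` terms costs at most `2ρ²/(ρ-1) · ρ^(1-j)` on `[-1, 1]` (`exists_cos_series_approx`). The vectors
`(T_m(x_k))_k`, `m < j`, are common to all rows, so the matrix is entrywise close to one of rank at
most `j`, which bounds its singular value of zero-based index `j` (`sigmaSucc_le_of_entry_approx`).
-/

/-- If `T` is bounded by `c` on the common kernel of `n` linear functionals, then the singular
value of `T` with (zero-based) index `n` is at most `c`. -/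
theorem LinearMap.singularValues_le_of_norm_le_on_ker {E F : Type*}
    [NormedAddCommGroup E] [InnerProductSpace ℝ E] [FiniteDimensional ℝ E]
    [NormedAddCommGroup F] [InnerProductSpace ℝ F] [FiniteDimensional ℝ F]
    (T : E →ₗ[ℝ] F) {n : ℕ} (Q : E →ₗ[ℝ] (Fin n → ℝ)) {c : ℝ} (hc : 0 ≤ c)
    (h : ∀ x, Q x = 0 → ‖T x‖ ≤ c * ‖x‖) : T.singularValues n ≤ c := by
  by_cases hn : Module.finrank ℝ E ≤ n
  · rwa [T.singularValues_of_finrank_le hn]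
  push Not at hn
  have hT := T.isSymmetric_adjoint_comp_self
  let e : Fin (n + 1) → Fin (Module.finrank ℝ E) := Fin.castLE hn
  have he : Function.Injective e := Fin.castLE_injective hn
  let b : Fin (n + 1) → E := fun i => hT.eigenvectorBasis rfl (e i)
  have hb : Orthonormal ℝ b := (hT.eigenvectorBasis rfl).orthonormal.comp e he
  -- Dimension count: the span of the top `n + 1` right singular vectors meets the kernel of `Q`. On
  -- that span `T` stretches by at least its singular value of index `n`.
  obtain ⟨y, hyQ, hy0⟩ : ∃ y : Fin (n + 1) → ℝ,
      (Q ∘ₗ Fintype.linearCombination ℝ b) y = 0 ∧ y ≠ 0 := by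
    have hker : LinearMap.ker (Q ∘ₗ Fintype.linearCombination ℝ b) ≠ ⊥ :=
      LinearMap.ker_ne_bot_of_finrank_lt (by simp)
    obtain ⟨y, hy, hy0⟩ := Submodule.exists_mem_ne_zero_of_ne_bot hker
    exact ⟨y, hy, hy0⟩
  have hx := h (∑ i, y i • b i) (by simpa [Fintype.linearCombination_apply] using hyQ)
  have hnorm : ‖∑ i, y i • b i‖ ^ 2 = ∑ i, y i ^ 2 := by
    rw [← real_inner_self_eq_norm_sq, hb.inner_sum]
    simp [sq]
  have hTnorm : ‖T (∑ i, y i • b i)‖ ^ 2 = ∑ i : Fin (n + 1), T.singularValues i ^ 2 * y i ^ 2 := by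
    rw [← real_inner_self_eq_norm_sq, ← LinearMap.adjoint_inner_right, ← LinearMap.comp_apply,
      map_sum]
    have : ∀ i, (LinearMap.adjoint T ∘ₗ T) (y i • b i) = (y i * T.singularValues i ^ 2) • b i := by
      intro i
      have h1 := T.sq_singularValues_fin rfl (e i)
      have h2 := hT.apply_eigenvectorBasis rfl (e i)
      rw [map_smul, h2, smul_smul]
      change _ = (y i * T.singularValues (e i) ^ 2) • b i
      rw [h1]
      rfl
    simp_rw [this]
    rw [hb.inner_sum]
    refine Finset.sum_congr rfl fun i _ => ?_
    simp only [conj_trivial]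
    ring
  have hle : T.singularValues n ^ 2 * ∑ i, y i ^ 2 ≤ c ^ 2 * ∑ i, y i ^ 2 := by
    calc T.singularValues n ^ 2 * ∑ i, y i ^ 2
        ≤ ∑ i : Fin (n + 1), T.singularValues i ^ 2 * y i ^ 2 := by
          rw [Finset.mul_sum]
          refine Finset.sum_le_sum fun i _ => ?_
          have h1 := T.singularValues_antitone (Nat.lt_succ_iff.mp i.2)
          have h2 := T.singularValues_nonneg n
          gcongr
      _ = ‖T (∑ i, y i • b i)‖ ^ 2 := hTnorm.symm
      _ ≤ (c * ‖∑ i, y i • b i‖) ^ 2 := by gcongr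
      _ = c ^ 2 * ∑ i, y i ^ 2 := by rw [mul_pow, hnorm]
  have hpos : 0 < ∑ i, y i ^ 2 := by
    obtain ⟨i, hi⟩ := Function.ne_iff.mp hy0
    exact Finset.sum_pos' (fun i _ => sq_nonneg _) ⟨i, Finset.mem_univ _, sq_pos_of_ne_zero hi⟩
  exact le_of_sq_le_sq (le_of_mul_le_mul_right hle hpos) hc

/-- If the rows of a matrix are within `ε`, entrywise, of linear combinations of `n` fixed
vectors, then its singular value with (zero-based) index `n` is at most `√(dL) ε`. -/
theorem sigmaSucc_le_of_entry_approx {d L n : ℕ} (A : Matrix (Fin d) (Fin L) ℝ)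
    (c : Fin d → ℕ → ℝ) (p : ℕ → Fin L → ℝ) {ε : ℝ} (hε : 0 ≤ ε)
    (h : ∀ i k, |A i k - ∑ m ∈ Finset.range n, c i m * p m k| ≤ ε) :
    sigmaSucc A n ≤ √((d : ℝ) * L) * ε := by
  let Q : EuclideanSpace ℝ (Fin L) →ₗ[ℝ] (Fin n → ℝ) :=
    (Matrix.of fun (m : Fin n) k => p m k).mulVecLin ∘ₗ
      (WithLp.linearEquiv 2 ℝ (Fin L → ℝ)).toLinearMap
  refine LinearMap.singularValues_le_of_norm_le_on_ker _ Q (by positivity) fun u hu => ?_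
  have hu' : ∀ m ∈ Finset.range n, ∑ k, p m k * u k = 0 := fun m hm => by
    simpa [Q, Matrix.mulVec, dotProduct] using congrFun hu ⟨m, Finset.mem_range.mp hm⟩
  have hsum : (∑ k, |u k|) ^ 2 ≤ L * ‖u‖ ^ 2 := by
    have := sq_sum_le_card_mul_sum_sq (s := Finset.univ) (f := fun k => |u k|)
    simpa [EuclideanSpace.norm_sq_eq] using this
  have hentry : ∀ i, (A.toEuclideanLin u) i ^ 2 ≤ L * ‖u‖ ^ 2 * ε ^ 2 := fun i => by
    have h1 : (A.toEuclideanLin u) i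
        = ∑ k, (A i k - ∑ m ∈ Finset.range n, c i m * p m k) * u k := by
      -- On the kernel of `Q` the approximants contribute nothing; only the entrywise errors act on
      -- `u`.
      have h2 : ∑ k, (∑ m ∈ Finset.range n, c i m * p m k) * u k = 0 := by
        simp_rw [Finset.sum_mul]
        rw [Finset.sum_comm]
        refine Finset.sum_eq_zero fun m hm => ?_
        simp_rw [mul_assoc]
        rw [← Finset.mul_sum, hu' m hm, mul_zero]
      simp_rw [sub_mul]
      rw [Finset.sum_sub_distrib, h2, sub_zero]
      simp [Matrix.toLpLin_apply, Matrix.mulVec, dotProduct]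
    have h3 : |(A.toEuclideanLin u) i| ≤ ε * ∑ k, |u k| := by
      rw [h1, Finset.mul_sum]
      refine (Finset.abs_sum_le_sum_abs _ _).trans (Finset.sum_le_sum fun k _ => ?_)
      rw [abs_mul]
      gcongr
      exact h i k
    calc (A.toEuclideanLin u) i ^ 2 = |(A.toEuclideanLin u) i| ^ 2 := (sq_abs _).symm
      _ ≤ (ε * ∑ k, |u k|) ^ 2 := by gcongr
      _ = ε ^ 2 * (∑ k, |u k|) ^ 2 := mul_pow _ _ _
      _ ≤ ε ^ 2 * (L * ‖u‖ ^ 2) := by gcongr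
      _ = _ := by ring
  refine le_of_sq_le_sq ?_ (by positivity)
  calc ‖A.toEuclideanLin u‖ ^ 2 = ∑ i, (A.toEuclideanLin u) i ^ 2 := by
        simp [EuclideanSpace.norm_sq_eq]
    _ ≤ ∑ _i : Fin d, L * ‖u‖ ^ 2 * ε ^ 2 := Finset.sum_le_sum fun i _ => hentry i
    _ = (√((d : ℝ) * L) * ε * ‖u‖) ^ 2 := by
        rw [mul_pow, mul_pow, Real.sq_sqrt (by positivity)]
        simp
        ring

/-! ### Laurent series and Chebyshev truncation -/

/-- The Laurent coefficient of index `n` of `g`, as an integral over the unit circle. -/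
noncomputable def laurentCoeff (g : ℂ → ℂ) (n : ℤ) : ℂ :=
  (2 * π * Complex.I : ℂ)⁻¹ • ∮ z in C(0, 1), z ^ (-n - 1) * g z

/-- Cauchy's estimate for Laurent coefficients on a closed annulus around the unit circle. -/
theorem norm_laurentCoeff_le {g : ℂ → ℂ} {ρ M : ℝ} (hρ : 1 < ρ)
    (hd : ∀ z : ℂ, ρ⁻¹ ≤ ‖z‖ → ‖z‖ ≤ ρ → DifferentiableAt ℂ g z)
    (hM : ∀ z : ℂ, ρ⁻¹ ≤ ‖z‖ → ‖z‖ ≤ ρ → ‖g z‖ ≤ M) (n : ℤ) :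
    ‖laurentCoeff g n‖ ≤ M * (ρ⁻¹) ^ n.natAbs := by
  have hρ0 : 0 < ρ := one_pos.trans hρ
  have hρi : ρ⁻¹ < 1 := inv_lt_one_of_one_lt₀ hρ
  have hM0 : 0 ≤ M := (norm_nonneg _).trans (hM 1 (by simpa using hρi.le) (by simpa using hρ.le))
  have hdiff : ∀ z : ℂ, ρ⁻¹ ≤ ‖z‖ → ‖z‖ ≤ ρ →
      DifferentiableAt ℂ (fun z => z ^ (-n - 1) * g z) z := fun z h1 h2 => by
    have hz : z ≠ 0 := norm_pos_iff.mp ((inv_pos.mpr hρ0).trans_le h1)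
    exact (differentiableAt_zpow.mpr (Or.inl hz)).mul (hd z h1 h2)
  have shift : ∀ r R : ℝ, ρ⁻¹ ≤ r → r ≤ R → R ≤ ρ →
      (∮ z in C(0, R), z ^ (-n - 1) * g z) = ∮ z in C(0, r), z ^ (-n - 1) * g z := by
    intro r R hr hrR hR
    refine Complex.circleIntegral_eq_of_differentiable_on_annulus_off_countable
      ((inv_pos.mpr hρ0).trans_le hr) hrR Set.countable_empty (fun z hz => ?_) (fun z hz => ?_)
    · simp only [Set.mem_sdiff, Metric.mem_closedBall, Metric.mem_ball, dist_zero_right,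
        not_lt] at hz
      exact (hdiff z (hr.trans hz.2) (hz.1.trans hR)).continuousAt.continuousWithinAt
    · simp only [Set.mem_sdiff, Metric.mem_closedBall, Metric.mem_ball, dist_zero_right,
        not_le, Set.mem_empty_iff_false, not_false_eq_true, and_true] at hz
      exact hdiff z (hr.trans hz.2.le) (hz.1.le.trans hR)
  have bound : ∀ r : ℝ, ρ⁻¹ ≤ r → r ≤ ρ →
      ‖(2 * π * Complex.I : ℂ)⁻¹ • ∮ z in C(0, r), z ^ (-n - 1) * g z‖ ≤ M * r ^ (-n) := by
    intro r h1 h2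
    have hr : 0 < r := (inv_pos.mpr hρ0).trans_le h1
    have := circleIntegral.norm_two_pi_i_inv_smul_integral_le_of_norm_le_const
      (c := 0) (f := fun z => z ^ (-n - 1) * g z) (C := r ^ (-n - 1) * M) hr.le (fun z hz => by
        have hz' : ‖z‖ = r := by simpa using hz
        rw [norm_mul, norm_zpow, hz']
        gcongr
        exact hM z (by rwa [hz']) (by rwa [hz']))
    refine this.trans_eq ?_
    rw [zpow_sub₀ hr.ne', zpow_one]
    field_simp
  -- The circle is moved to radius `ρ` for `n ≥ 0` and to `ρ⁻¹` for `n ≤ 0`, so both signs give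
  -- decay.
  rcases le_total 0 n with hn | hn
  · lift n to ℕ using hn
    have := bound ρ (hρi.le.trans hρ.le) le_rfl
    rw [shift 1 ρ hρi.le hρ.le le_rfl] at this
    simpa [laurentCoeff] using this
  · obtain ⟨m, rfl⟩ := Int.exists_eq_neg_ofNat hn
    have := bound ρ⁻¹ le_rfl (hρi.le.trans hρ.le)
    rw [← shift ρ⁻¹ 1 le_rfl hρi.le hρ.le] at this
    simpa [laurentCoeff] using this

instance fact_two_pi_pos : Fact (0 < 2 * π) := ⟨Real.two_pi_pos⟩

/-- On the unit circle, a function holomorphic near it is the sum of its Laurent series. -/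
theorem hasSum_laurentCoeff {g : ℂ → ℂ} {ρ M : ℝ} (hρ : 1 < ρ)
    (hd : ∀ z : ℂ, ρ⁻¹ ≤ ‖z‖ → ‖z‖ ≤ ρ → DifferentiableAt ℂ g z)
    (hM : ∀ z : ℂ, ρ⁻¹ ≤ ‖z‖ → ‖z‖ ≤ ρ → ‖g z‖ ≤ M) (θ : ℝ) :
    HasSum (fun n : ℤ => laurentCoeff g n * Complex.exp (n * θ * Complex.I))
      (g (Complex.exp (θ * Complex.I))) := by
  have hρi : ρ⁻¹ < 1 := inv_lt_one_of_one_lt₀ hρ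
  let G : C(AddCircle (2 * π), ℂ) := ⟨fun t => g (AddCircle.toCircle t), by
    refine continuous_iff_continuousAt.mpr fun t => ?_
    refine ContinuousAt.comp (f := fun t : AddCircle (2 * π) => (AddCircle.toCircle t : ℂ)) ?_ ?_
    · exact (hd _ (by rw [Circle.norm_coe]; exact hρi.le) (by rw [Circle.norm_coe]; exact hρ.le)).continuousAt
    · exact (continuous_subtype_val.comp AddCircle.continuous_toCircle).continuousAt⟩
  have hG : ∀ t : ℝ, G t = g (Complex.exp (t * Complex.I)) := fun t => by
    simp [G, AddCircle.toCircle_apply_mk]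
  -- Restricted to the unit circle, Laurent coefficients are Fourier coefficients, so their
  -- summability yields pointwise convergence.
  have hcoeff : ∀ n, fourierCoeff G n = laurentCoeff g n := fun n => by
    rw [fourierCoeff_eq_intervalIntegral _ n 0, laurentCoeff, circleIntegral, zero_add,
      Complex.real_smul, smul_eq_mul, mul_inv _ Complex.I, mul_assoc (2 * π : ℂ)⁻¹,
      ← intervalIntegral.integral_const_mul Complex.I⁻¹]
    congr 1
    · push_cast
      rw [one_div]
    refine intervalIntegral.integral_congr fun t _ => ?_
    simp only [hG, deriv_circleMap, circleMap, fourier_coe_apply, smul_eq_mul]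
    have h0 : Complex.exp (t * Complex.I) ≠ 0 := Complex.exp_ne_zero _
    have h1 : Complex.exp (2 * π * Complex.I * ((-n : ℤ) : ℂ) * t / ((2 * π : ℝ) : ℂ))
        = Complex.exp (t * Complex.I) ^ (-n) := by
      rw [← Complex.exp_int_mul]
      congr 1
      have : (π : ℂ) ≠ 0 := by exact_mod_cast Real.pi_ne_zero
      push_cast
      field_simp
    rw [h1]
    simp only [Complex.ofReal_one, one_mul, zero_add, zpow_sub₀ h0, zpow_one]
    have := Complex.I_ne_zero
    field_simp
  have hsum : Summable (fourierCoeff G) := by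
    have hgeo : Summable fun n : ℤ => M * (ρ⁻¹) ^ n.natAbs := by
      refine Summable.mul_left _ ?_
      have h := summable_geometric_of_lt_one (inv_nonneg.mpr (one_pos.trans hρ).le) hρi
      exact Summable.of_nat_of_neg (by simpa using h) (by simpa using h)
    refine Summable.of_norm_bounded hgeo fun n => ?_
    rw [hcoeff]
    exact norm_laurentCoeff_le hρ hd hM n
  have := has_pointwise_sum_fourier_series_of_summable hsum (θ : AddCircle (2 * π))
  rw [hG] at this
  convert! this using 2 with n
  rw [hcoeff, fourier_coe_apply, smul_eq_mul]
  congr 2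
  have : (π : ℂ) ≠ 0 := by exact_mod_cast Real.pi_ne_zero
  push_cast
  field_simp

/-- **Bernstein's theorem** on Chebyshev truncation: a function holomorphic and bounded by `M` on
the closed Bernstein ellipse of parameter `ρ` is approximated on `[-1, 1]` by its Chebyshev series
truncated at degree `n` within `2 M ρ ^ (1 - n) / (ρ - 1)`. -/
theorem exists_cos_series_approx {f : ℂ → ℂ} {ρ M : ℝ} (hρ : 1 < ρ)
    (hd : ∀ z : ℂ, ρ⁻¹ ≤ ‖z‖ → ‖z‖ ≤ ρ → DifferentiableAt ℂ f ((z + z⁻¹) / 2))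
    (hM : ∀ z : ℂ, ρ⁻¹ ≤ ‖z‖ → ‖z‖ ≤ ρ → ‖f ((z + z⁻¹) / 2)‖ ≤ M) :
    ∃ c : ℕ → ℝ, ∀ (n : ℕ) (θ : ℝ),
      |(f (Real.cos θ)).re - ∑ m ∈ Finset.range n, c m * Real.cos (m * θ)|
        ≤ 2 * M / (ρ - 1) * ρ ^ (-(n : ℤ) + 1) := by
  have hρ0 : 0 < ρ := one_pos.trans hρ
  have hρi : ρ⁻¹ < 1 := inv_lt_one_of_one_lt₀ hρ
  set g : ℂ → ℂ := fun z => f ((z + z⁻¹) / 2) with hg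
  have hgd : ∀ z : ℂ, ρ⁻¹ ≤ ‖z‖ → ‖z‖ ≤ ρ → DifferentiableAt ℂ g z := fun z h1 h2 => by
    have hz : z ≠ 0 := norm_pos_iff.mp ((inv_pos.mpr hρ0).trans_le h1)
    exact (hd z h1 h2).comp z (((differentiableAt_id).add (differentiableAt_inv hz)).div_const 2)
  have hM0 : 0 ≤ M := (norm_nonneg _).trans (hM 1 (by simpa using hρi.le) (by simpa using hρ.le))
  let a : ℤ → ℂ := laurentCoeff g
  have ha : ∀ n, ‖a n‖ ≤ M * (ρ⁻¹) ^ n.natAbs := norm_laurentCoeff_le hρ hgd hM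
  -- Folding `n` with `-n` counts index `0` twice, hence the correction.
  let c : ℕ → ℂ := fun n => a n + a (-n) - if n = 0 then a 0 else 0
  have hc : ∀ n, ‖c n‖ ≤ 2 * M * (ρ⁻¹) ^ n := fun n => by
    rcases eq_or_ne n 0 with rfl | hn
    · have := ha 0
      simp [c] at this ⊢
      linarith
    · have h1 := ha n
      have h2 := ha (-n)
      have h3 := norm_add_le (a n) (a (-n))
      simp [c, hn] at h1 h2 h3 ⊢
      linarith
  have hsum : ∀ θ : ℝ, HasSum (fun n : ℕ => c n * (Real.cos (n * θ) : ℂ)) (f (Real.cos θ)) := by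
    intro θ
    have hcos : ∀ t : ℝ, g (Complex.exp (t * Complex.I)) = f (Real.cos t) := fun t => by
      simp only [hg]
      rw [Complex.ofReal_cos, Complex.cos, ← Complex.exp_neg, neg_mul]
    have h1 := hasSum_laurentCoeff hρ hgd hM θ
    -- `cos` is even, so averaging the series at `θ` and `-θ` turns exponentials into cosines.
    have h2 := hasSum_laurentCoeff hρ hgd hM (-θ)
    rw [hcos] at h1 h2
    rw [Real.cos_neg] at h2
    have h3 := (h1.add h2).div_const 2
    rw [add_self_div_two] at h3
    have h4 : HasSum (fun n : ℤ => a n * (Real.cos (n * θ) : ℂ)) (f (Real.cos θ)) := by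
      convert! h3 using 2 with n
      rw [Complex.ofReal_cos, Complex.cos]
      push_cast
      simp only [a, neg_mul, mul_neg]
      ring
    have h5 := h4.nat_add_neg.sub (hasSum_ite_eq 0 (a 0))
    simp only [Int.cast_zero, zero_mul, Real.cos_zero, Complex.ofReal_one, mul_one,
      add_sub_cancel_right] at h5
    convert! h5 using 2 with n
    rcases eq_or_ne n 0 with rfl | hn
    · simp [c]
    · simp [c, hn, add_mul]
  refine ⟨fun n => (c n).re, fun n θ => ?_⟩
  have hre : HasSum (fun m : ℕ => (c m).re * Real.cos (m * θ)) (f (Real.cos θ)).re := by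
    simpa only [Complex.re_mul_ofReal] using Complex.hasSum_re (hsum θ)
  have htail := (hasSum_nat_add_iff' n).mpr hre
  have hgeo : HasSum (fun m : ℕ => 2 * M * (ρ⁻¹) ^ (m + n)) (2 * M / (ρ - 1) * ρ ^ (-(n : ℤ) + 1)) := by
    have := (hasSum_geometric_of_lt_one (inv_nonneg.mpr hρ0.le) hρi).mul_left (2 * M * (ρ⁻¹) ^ n)
    convert! this using 1
    · ext m
      rw [pow_add]
      ring
    · have h1 : ρ - 1 ≠ 0 := by linarith
      rw [zpow_add₀ hρ0.ne', zpow_neg, zpow_natCast, zpow_one, inv_pow]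
      have h2 : 1 - ρ⁻¹ = (ρ - 1) / ρ := by field_simp
      rw [h2]
      field_simp
  refine htail.norm_le_of_bounded hgeo fun m => ?_
  rw [Real.norm_eq_abs, abs_mul]
  calc |(c (m + n)).re| * |Real.cos ((m + n : ℕ) * θ)| ≤ ‖c (m + n)‖ * 1 := by
        gcongr
        · exact Complex.abs_re_le_norm _
        · exact Real.abs_cos_le_one _
    _ ≤ 2 * M * (ρ⁻¹) ^ (m + n) := by simpa using hc (m + n)

/-! ### Geometry of the ellipse and the logistic factor -/

/-- On the Bernstein ellipse of parameter `1 + s` imaginary parts are at most `s`. -/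
theorem abs_im_joukowski_le {s : ℝ} (hs : 0 < s) {z : ℂ} (h1 : (1 + s)⁻¹ ≤ ‖z‖)
    (h2 : ‖z‖ ≤ 1 + s) : |((z + z⁻¹) / 2).im| ≤ s := by
  have hs1 : 0 < 1 + s := by linarith
  have hz : 0 < ‖z‖ := (inv_pos.mpr hs1).trans_le h1
  have hinv : ‖z‖⁻¹ ≤ 1 + s := inv_le_of_inv_le₀ hs1 h1
  have him : ((z + z⁻¹) / 2).im = z.im / ‖z‖ * ((‖z‖ - ‖z‖⁻¹) / 2) := by
    have : ((z + z⁻¹) / 2).im = (z + z⁻¹).im / 2 := by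
      simp
    rw [this, Complex.add_im, Complex.inv_im, Complex.normSq_eq_norm_sq]
    field_simp
    ring
  have h3 : |z.im / ‖z‖| ≤ 1 := by
    rw [abs_div, abs_norm]
    exact div_le_one_of_le₀ (Complex.abs_im_le_norm z) hz.le
  -- The vertical semi-axis `(ρ - ρ⁻¹)/2` is at most `s` because `(1 + s)⁻¹ ≥ 1 - s`.
  have hlow : ∀ r : ℝ, 0 < r → r ≤ 1 + s → (r - r⁻¹) / 2 ≤ s := fun r hr hrs => by
    have h4 : (1 + s)⁻¹ ≤ r⁻¹ := by gcongr
    have h5 : 1 - s ≤ (1 + s)⁻¹ := by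
      rw [← one_div, le_div_iff₀ hs1]
      nlinarith
    linarith
  have h6 : |(‖z‖ - ‖z‖⁻¹) / 2| ≤ s := by
    rw [abs_le]
    refine ⟨?_, hlow _ hz h2⟩
    have := hlow _ (inv_pos.mpr hz) hinv
    rw [inv_inv] at this
    linarith
  rw [him, abs_mul]
  exact (mul_le_mul h3 h6 (abs_nonneg _) zero_le_one).trans_eq (one_mul s)

/-- Points of the Bernstein ellipse of parameter `ρ` have modulus at most `ρ`. -/
theorem norm_joukowski_le {ρ : ℝ} (hρ : 0 < ρ) {z : ℂ} (h1 : ρ⁻¹ ≤ ‖z‖) (h2 : ‖z‖ ≤ ρ) :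
    ‖(z + z⁻¹) / 2‖ ≤ ρ := by
  have hinv : ‖z‖⁻¹ ≤ ρ := inv_le_of_inv_le₀ hρ h1
  have h3 := norm_add_le z z⁻¹
  rw [norm_inv] at h3
  rw [norm_div, Complex.norm_ofNat]
  linarith

/-- In the strip `|b Im z| ≤ π / 2` the denominator of the logistic function stays away from `0`. -/
theorem one_le_norm_one_add_exp {c : ℝ} {z : ℂ} (h : |c * z.im| ≤ π / 2) :
    1 ≤ ‖1 + Complex.exp (-(c * z))‖ := by
  have hre : 0 ≤ (Complex.exp (-(c * z))).re := by
    rw [Complex.exp_re]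
    refine mul_nonneg (Real.exp_pos _).le (Real.cos_nonneg_of_mem_Icc ?_)
    rw [abs_le] at h
    constructor <;> simp <;> linarith
  have := Complex.re_le_norm (1 + Complex.exp (-(c * z)))
  simp only [Complex.add_re, Complex.one_re] at this
  linarith

/-- Chebyshev approximation of `x ↦ a x² / (1 + exp (-c x))` on `[-1, 1]`, uniformly in `|a| ≤ 1`
and `|c| ≤ b`. -/
theorem exists_cos_approx_sq_logistic {b : ℝ} (hb : 0 < b) {a c : ℝ} (ha : |a| ≤ 1)
    (hc : |c| ≤ b) :
    ∃ q : ℕ → ℝ, ∀ (n : ℕ) (θ : ℝ),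
      |a * Real.cos θ ^ 2 / (1 + Real.exp (-(c * Real.cos θ)))
          - ∑ m ∈ Finset.range n, q m * Real.cos (m * θ)|
        ≤ 6 * (b + b⁻¹) * (1 + π / (2 * b)) ^ (-(n : ℤ) + 1) := by
  -- Chosen so that `b * s = π / 2`: on the ellipse the exponential then has nonnegative real part.
  set s := π / (2 * b) with hs
  have hs0 : 0 < s := by positivity
  let f : ℂ → ℂ := fun z => a * z ^ 2 / (1 + Complex.exp (-(c * z)))
  have hden : ∀ z : ℂ, (1 + s)⁻¹ ≤ ‖z‖ → ‖z‖ ≤ 1 + s →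
      1 ≤ ‖1 + Complex.exp (-(c * ((z + z⁻¹) / 2)))‖ := fun z h1 h2 => by
    refine one_le_norm_one_add_exp ?_
    rw [abs_mul]
    calc |c| * |((z + z⁻¹) / 2).im| ≤ b * s := by
          gcongr
          exact abs_im_joukowski_le hs0 h1 h2
      _ = π / 2 := by rw [hs]; field_simp
  obtain ⟨q, hq⟩ := exists_cos_series_approx (f := f) (ρ := 1 + s) (M := (1 + s) ^ 2) (by linarith)
    (fun z h1 h2 => by
      have : 1 + Complex.exp (-(c * ((z + z⁻¹) / 2))) ≠ 0 :=
        norm_pos_iff.mp (one_pos.trans_le (hden z h1 h2))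
      exact DifferentiableAt.div (by fun_prop) (by fun_prop) this)
    (fun z h1 h2 => by
      have h3 := norm_joukowski_le (by linarith) h1 h2
      rw [norm_div, norm_mul, norm_pow, Complex.norm_real, Real.norm_eq_abs]
      refine (div_le_self (by positivity) (hden z h1 h2)).trans ?_
      calc |a| * ‖(z + z⁻¹) / 2‖ ^ 2 ≤ 1 * (1 + s) ^ 2 := by gcongr
        _ = _ := one_mul _)
  refine ⟨q, fun n θ => ?_⟩
  have hf : (f (Real.cos θ)).re
      = a * Real.cos θ ^ 2 / (1 + Real.exp (-(c * Real.cos θ))) := by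
    have : f (Real.cos θ)
        = ((a * Real.cos θ ^ 2 / (1 + Real.exp (-(c * Real.cos θ))) : ℝ) : ℂ) := by
      simp [f]
    rw [this, Complex.ofReal_re]
  rw [← hf]
  refine (hq n θ).trans ?_
  gcongr
  rw [add_sub_cancel_left]
  -- The prefactor `2M/(ρ-1)`; its middle term `4` is absorbed by `b + b⁻¹ ≥ 2`.
  have h1 : 2 * (1 + s) ^ 2 / s = 4 / π * b + 4 + π * b⁻¹ := by
    rw [hs]
    field_simp
    ring
  have h2 : 4 / π ≤ 2 := by
    rw [div_le_iff₀ Real.pi_pos]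
    linarith [Real.pi_gt_three]
  have h3 : 2 ≤ b + b⁻¹ := by
    have : b + b⁻¹ - 2 = (b - 1) ^ 2 / b := by
      field_simp
      ring
    have : 0 ≤ (b - 1) ^ 2 / b := by positivity
    linarith
  have h4 : 4 / π * b ≤ 2 * b := by gcongr
  have h5 : π * b⁻¹ ≤ 4 * b⁻¹ := by
    gcongr
    exact Real.pi_le_four
  rw [h1]
  have := inv_pos.mpr hb
  linarith

/-- Common form of both embeddings: `a i = w i * v i`, with `c i = β * w i`, `b = β * W` in one case
and `c i = b = β` in the other. -/
theorem sigmaSucc_embeddedInput_le {d L : ℕ} {b : ℝ} (hb : 0 < b) (a c : Fin d → ℝ)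
    (ha : ∀ i, |a i| ≤ 1) (hc : ∀ i, |c i| ≤ b) (x : Fin L → ℝ)
    (hx : ∀ k, x k ∈ Set.Icc (-1 : ℝ) 1) (j : ℕ) :
    sigmaSucc (embeddedInput (fun i t => a i * t ^ 2 / (1 + Real.exp (-(c i * t)))) x) j
      ≤ 6 * moeRate d L b j := by
  choose q hq using fun i => exists_cos_approx_sq_logistic hb (ha i) (hc i)
  have := sigmaSucc_le_of_entry_approx (n := j)
    (embeddedInput (fun i t => a i * t ^ 2 / (1 + Real.exp (-(c i * t)))) x) q
    -- The Chebyshev value `T_m(x_k)`, independent of the row.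
    (fun m k => Real.cos (m * Real.arccos (x k)))
    (ε := 6 * (b + b⁻¹) * (1 + π / (2 * b)) ^ (-(j : ℤ) + 1)) (by positivity)
    (fun i k => by
      have := hq i j (Real.arccos (x k))
      rwa [Real.cos_arccos (hx k).1 (hx k).2] at this)
  refine this.trans_eq ?_
  rw [moeRate]
  ring

theorem mainTheorem7 :
    ∃ C : ℝ, 0 < C ∧
      ∀ (d L : ℕ) (β : ℝ), 0 < β →
      ∀ (w v : Fin d → ℝ), (∀ i, |w i * v i| ≤ 1) →
      ∀ (x : Fin L → ℝ), (∀ k, x k ∈ Set.Icc (-1 : ℝ) 1) →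
        (∀ W : ℝ, 0 < W → (∀ i, |w i| ≤ W) → ∀ j : ℕ,
          sigmaSucc (embeddedInput (fun i => timeMoE β (w i) (v i)) x) j
            ≤ C * moeRate d L (β * W) j) ∧
        (∀ j : ℕ,
          sigmaSucc (embeddedInput (fun i => timeMoEUnscaled β (w i) (v i)) x) j
            ≤ C * moeRate d L β j) := by
  refine ⟨6, by norm_num, fun d L β hβ w v hwv x hx => ⟨fun W hW hwW j => ?_, fun j => ?_⟩⟩
  · have heq : (fun i => timeMoE β (w i) (v i))
        = fun i t => w i * v i * t ^ 2 / (1 + Real.exp (-(β * w i * t))) := by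
      funext i t
      simp only [timeMoE, swish, mul_assoc]
      ring
    rw [heq]
    refine sigmaSucc_embeddedInput_le (mul_pos hβ hW) _ _ hwv (fun i => ?_) x hx j
    rw [abs_mul, abs_of_pos hβ]
    gcongr
    exact hwW i
  · exact sigmaSucc_embeddedInput_le hβ _ (fun _ => β) hwv (fun _ => (abs_of_pos hβ).le) x hx j
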